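/- **Model.** Fix $n$. A network is a graph $G=(V,E)$ with $V\subseteq[n]$ (the elements of $[n]$ are the node identifiers). Time proceeds in synchronous rounds $0,1,2,\dots$; the network in round $i$ is $G_i=(V_i,E_i)$, and the sequence $(G_i)$ is arbitrary. The topology changes of round $i\ge 1$ lead from $G_{i-1}$ to $G_i$: node insertions ($V_i\setminus V_{i-1}$), node deletions ($V_{i-1}\setminus V_i$), and insertions/deletions of edges both of whose endpoints are in $V_{i-1}\cap V_i$. Arbitrarily many changes may occur in a round, and inserting or deleting a node together with all its edges is one change. Deletions are abrupt: in round $i$ every node of $V_i$ first learns, a posteriori, its current neighbors and which of its incident edges were inserted or deleted, and which of its current (former) neighbors are newly inserted (deleted) nodes. Then it sends a message of $O(\log n)$ bits to each of its neighbors in $G_i$, receives their messages and updates its state. A node knows its identifier, $n$, and the round number modulo $15n$; a (re)inserted node starts in a fresh state. A node stores a label ("unmatched" or "matched to $u$") and a flag (dirty or clean). The labeled star of $v$ is *consistent* if: whenever $v$ is labeled matched to $u$, $u$ is a neighbor of $v$; for every neighbor $u$ of $v$, $v$ is labeled matched to $u$ if and only if $u$ is labeled matched to $v$; and if $v$ is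 unmatched then no neighbor of $v$ is unmatched. (All stars are consistent if and only if the labels describe a maximal matching.) Let $\mathrm{incorrect}(i)$ be the number of rounds $r\le i$ at the end of which some star of $G_r$ is inconsistent, and $\mathrm{changes}(i)$ the number of topology changes until round $i$. **Theorem.** There are an absolute constant $k$ and, for every $n$, a deterministic distributed algorithm with $O(\log n)$-bit messages (with an absolute implied constant) such that for every sequence $(G_i)$ and every initial labeling that describes a maximal matching of $G_0$, with no node initially dirty: 1. $\mathrm{incorrect}(i)\le k\cdot\mathrm{changes}(i)$ for all $i$; that is, the algorithm maintains a maximal matching under edge/node insertions and abrupt edge/node deletions in $O(1)$ amortized rounds. 2. The nodes that become dirty in a round are exactly the inserted nodes, the endpoints of inserted and deleted edges, and, for each deleted node $w$, the former neighbor that was labeled matched to $w$ (there is at most one such neighbor, so a change makes at most two nodes dirty). That is, these nodes are dirty at the end of the round, and every other dirty node was already dirty in the previous round. 3. At the end of every round, every clean node all of whose neighbors are clean has a consistent star; and the number of rounds up to $i$ in which some node is dirty is at most $k\cdot\mathrm{changes}(i)$. -/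

import Mathlib

/-!
Synchronous dynamic networks, deterministic message-passing algorithms on them, and the
amortized round complexity of fixing a maximal matching.
-/

namespace DynMM

/-- A network: the nodes currently present, out of the `n` possible identifiers, and the
edges between them. -/
structure Network (n : ℕ) where
  nodes : Finset (Fin n)
  graph : SimpleGraph (Fin n)
  mem_of_adj : ∀ {u v : Fin n}, graph.Adj u v → u ∈ nodes

/-- The label of a node: `none` is "unmatched", `some u` is "matched to `u`". -/
abbrev Label (n : ℕ) := Option (Fin n)

/-- The labeled star centered at `v` is consistent: matched edges are edges of the network on
which both endpoints agree, and if `v` is unmatched then none of its neighbors is unmatched.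
All stars are consistent iff the edges `{u, v}` with `L u = some v` form a maximal matching. -/
def StarConsistent {n : ℕ} (G : Network n) (L : Fin n → Label n) (v : Fin n) : Prop :=
  (∀ u, L v = some u → G.graph.Adj v u) ∧
  (∀ u, G.graph.Adj v u → (L v = some u ↔ L u = some v)) ∧
  (L v = none → ∀ u, G.graph.Adj v u → L u ≠ none)

/-- The labeling is a maximal matching of the network: all stars are consistent. -/
def Legal {n : ℕ} (G : Network n) (L : Fin n → Label n) : Prop :=
  ∀ v ∈ G.nodes, StarConsistent G L v

/-- `{u, v}` is an edge that is inserted or deleted by itself between `G` and `H`, that is,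
not as a part of the insertion or deletion of one of its endpoints. -/
def EdgeChanged {n : ℕ} (G H : Network n) (u v : Fin n) : Prop :=
  (u ∈ G.nodes ∧ u ∈ H.nodes) ∧ (v ∈ G.nodes ∧ v ∈ H.nodes) ∧
    Xor (G.graph.Adj u v) (H.graph.Adj u v)

open Classical in
/-- The number of topology changes from `G` to `H`: node insertions, node deletions and edge
insertions/deletions. The insertion (deletion) of a node together with all its edges
is one change. -/
noncomputable def numChanges {n : ℕ} (G H : Network n) : ℕ :=
  (H.nodes \ G.nodes).card + (G.nodes \ H.nodes).card +
    (Finset.univ.filter fun e : Sym2 (Fin n) => ∃ u v, e = s(u, v) ∧ EdgeChanged G H u v).card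

/-- What a node is told at the beginning of a round, after the topology changes: its current
neighbors and the changes that occurred to its incident edges. -/
structure Indication (n : ℕ) where
  /-- current neighbors -/
  nbrs : Finset (Fin n)
  /-- other endpoints of incident edges that were inserted -/
  edgeIns : Finset (Fin n)
  /-- other endpoints of incident edges that were deleted -/
  edgeDel : Finset (Fin n)
  /-- neighbors that are newly inserted nodes -/
  nodeIns : Finset (Fin n)
  /-- former neighbors that are deleted nodes -/
  nodeDel : Finset (Fin n)

open Classical in
/-- The current neighbors of `v`. -/
noncomputable def Network.nbrs {n : ℕ} (G : Network n) (v : Fin n) : Finset (Fin n) :=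
  Finset.univ.filter fun u => G.graph.Adj v u

open Classical in
/-- The indication that node `v` receives when the network changes from `G` to `H`. -/
noncomputable def indication {n : ℕ} (G H : Network n) (v : Fin n) : Indication n where
  nbrs := H.nbrs v
  edgeIns := Finset.univ.filter fun u => EdgeChanged G H v u ∧ H.graph.Adj v u
  edgeDel := Finset.univ.filter fun u => EdgeChanged G H v u ∧ G.graph.Adj v u
  nodeIns := Finset.univ.filter fun u => H.graph.Adj v u ∧ u ∉ G.nodes
  nodeDel := Finset.univ.filter fun u => G.graph.Adj v u ∧ u ∉ H.nodes

/-- A deterministic distributed algorithm for networks on at most `n` nodes, in which each node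
stores a label and a flag that says whether it is dirty. In a round, a node first receives its
indications (`wake`), then sends a message to each neighbor (`send`), and then receives the
messages of its neighbors (`recv`). The first argument of these three functions is the clock. -/
structure Algorithm (n : ℕ) where
  /-- local states -/
  State : Type
  /-- messages -/
  Msg : Type
  /-- there are finitely many messages -/
  fintypeMsg : Fintype Msg
  /-- state of a node of the initial network, given its identifier, neighbors and label -/
  start : Fin n → Finset (Fin n) → Label n → State
  /-- state of a newly inserted node, given its identifier -/
  fresh : Fin n → State
  wake : ℕ → Indication n → State → State
  /-- message (or silence) for each neighbor -/
  send : ℕ → State → Fin n → Option Msg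
  /-- update upon the messages received from the neighbors -/
  recv : ℕ → State → (Fin n → Option Msg) → State
  label : State → Label n
  dirty : State → Prop

attribute [instance] Algorithm.fintypeMsg

/-- The common clock: all nodes, also new ones, know the round number modulo `15 n`. -/
def clock (n i : ℕ) : ℕ := i % (15 * n)

open Classical in
/-- `A.state G L₀ i v` is the state of `v` at the end of round `i`, in the network that is `G i`
in round `i` and starts with the labels `L₀`. No changes and no communication take
place in round `0`. A node that is (re)inserted starts from a fresh state. States of absent nodes
have no meaning; such nodes have no neighbors and do not communicate. -/
noncomputable def Algorithm.state {n : ℕ} (A : Algorithm n) (G : ℕ → Network n)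
    (L₀ : Fin n → Label n) : ℕ → Fin n → A.State
  | 0 => fun v => A.start v ((G 0).nbrs v) (L₀ v)
  | i + 1 =>
    let awake : Fin n → A.State := fun v =>
      A.wake (clock n (i + 1)) (indication (G i) (G (i + 1)) v)
        (if v ∈ (G i).nodes then A.state G L₀ i v else A.fresh v)
    fun v => A.recv (clock n (i + 1)) (awake v) fun u =>
      if (G (i + 1)).graph.Adj u v then A.send (clock n (i + 1)) (awake u) v else none

/-- The labels at the end of round `i`. -/
noncomputable def Algorithm.labels {n : ℕ} (A : Algorithm n) (G : ℕ → Network n)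
    (L₀ : Fin n → Label n) (i : ℕ) (v : Fin n) : Label n :=
  A.label (A.state G L₀ i v)

/-- Node `v` is present and dirty at the end of round `i`. -/
def Algorithm.IsDirty {n : ℕ} (A : Algorithm n) (G : ℕ → Network n)
    (L₀ : Fin n → Label n) (i : ℕ) (v : Fin n) : Prop :=
  v ∈ (G i).nodes ∧ A.dirty (A.state G L₀ i v)

/-- The number of topology changes that occurred until round `i`. -/
noncomputable def changes {n : ℕ} (G : ℕ → Network n) (i : ℕ) : ℕ :=
  ∑ r ∈ Finset.range i, numChanges (G r) (G (r + 1))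

open Classical in
/-- The number of rounds until round `i` in which there is at least one inconsistent star. -/
noncomputable def Algorithm.incorrect {n : ℕ} (A : Algorithm n) (G : ℕ → Network n)
    (L₀ : Fin n → Label n) (i : ℕ) : ℕ :=
  ((Finset.range (i + 1)).filter fun r =>
    ∃ v ∈ (G r).nodes, ¬ StarConsistent (G r) (A.labels G L₀ r) v).card

open Classical in
/-- The number of rounds until round `i` in which there is at least one dirty node. -/
noncomputable def Algorithm.dirtyRounds {n : ℕ} (A : Algorithm n) (G : ℕ → Network n)
    (L₀ : Fin n → Label n) (i : ℕ) : ℕ :=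
  ((Finset.range (i + 1)).filter fun r => ∃ v, A.IsDirty G L₀ r v).card

/-- The topology changes from `G` to `H` require `v` to become dirty, where `L` is the labeling
before the changes: `v` is an inserted node, or an endpoint of an inserted or deleted edge, or the
neighbor that was matched to a deleted node. -/
def Affected {n : ℕ} (G H : Network n) (L : Fin n → Label n) (v : Fin n) : Prop :=
  v ∈ H.nodes ∧
    (v ∉ G.nodes ∨
     (∃ u, EdgeChanged G H v u) ∨
     (∃ w, G.graph.Adj v w ∧ w ∉ H.nodes ∧ L v = some w))

end DynMM

/-! ### The matching algorithm: epochs of announcing, proposing and accepting. -/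

namespace DynMM

/-! Matches are repaired in epochs of three rounds: announce, propose, accept. A label is dropped as
soon as its edge disappears, and both remaining endpoints notice this, so the labels always describe
a matching; the only possible defect is an edge with two unmatched endpoints. The invariant `Inv`
says that every such edge has a dirty endpoint. It survives topology changes because inserted nodes,
endpoints of changed edges and nodes that lose their partner become dirty (`AwakeInv.of_inv`). It
survives communication because a node is cleaned only when it is matched or has no unmatched
neighbor (`Inv.round`). So rounds with an inconsistent star are rounds with a dirty node, and it
suffices to count the latter.

The number of dirty nodes serves as a potential. A change adds at most two (`card_affected_le`), and
an epoch without changes removes at least one if there is any (`exists_cleaned`): if none were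
cleaned, the dirty node of least identifier would propose to an unmatched neighbor; that neighbor
cannot be a proposer itself, so it accepts some proposal, whose sender is dirty and becomes matched,
hence clean. With each dirty node worth three rounds, an epoch with `c ≥ 1` changes costs at most `3
+ 3 * 2 * c ≤ 9 * c`, which gives the constant `9` (`card_pos_le`). -/

/-- The least element of a set of identifiers, if there is one. -/
def least {n : ℕ} (U : Finset (Fin n)) : Option (Fin n) :=
  if h : U.Nonempty then some (U.min' h) else none

/-- The local state of the matching algorithm. -/
structure NodeState (n : ℕ) where
  id : Fin n
  /-- current neighbors -/
  nbrs : Finset (Fin n)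
  label : Label n
  dirty : Bool
  /-- the topology changes of the current round make the node dirty -/
  affected : Bool
  /-- the neighbor to which the node proposes in the current epoch -/
  prop : Option (Fin n)
  /-- the neighbor whose proposal the node accepts in the current epoch -/
  acc : Option (Fin n)

namespace NodeState

variable {n : ℕ}

def start (v : Fin n) (N : Finset (Fin n)) (l : Label n) : NodeState n :=
  ⟨v, N, l, false, false, none, none⟩

def fresh (v : Fin n) : NodeState n :=
  ⟨v, ∅, none, false, true, none, none⟩

/-- A node drops its label if the matched edge has disappeared. -/
def wake (ind : Indication n) (s : NodeState n) : NodeState n :=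
  let a := s.affected || decide (ind.edgeIns.Nonempty) || decide (ind.edgeDel.Nonempty) ||
    decide (∃ w ∈ ind.nodeDel, s.label = some w)
  { s with
    nbrs := ind.nbrs
    label := s.label.filter (fun u => decide (u ∈ ind.nbrs))
    dirty := s.dirty || a
    affected := a }

/-- In phase `0` the unmatched nodes tell their neighbors whether they are dirty, in phase `1`
nodes propose, and in phase `2` they accept a proposal. -/
def send (p : ℕ) (s : NodeState n) (u : Fin n) : Option Bool :=
  match p with
  | 0 => if s.label = none then some s.dirty else none
  | 1 => if s.prop = some u then some true else none
  | _ => if s.acc = some u then some true else none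

/-- The neighbors from which a message was received. -/
def senders (m : Fin n → Option Bool) : Finset (Fin n) :=
  Finset.univ.filter fun u => m u ≠ none

/-- The label at the end of an epoch. -/
def newLabel (s : NodeState n) (m : Fin n → Option Bool) : Label n :=
  s.label.or ((s.acc.filter fun u => decide (u ∈ s.nbrs)).or
    (s.prop.filter fun u => (m u).isSome))

/-- In phase `0`, a dirty node becomes clean if it is matched or has no unmatched neighbors, and
the dirty unmatched nodes that are minimal among their dirty unmatched neighbors choose an unmatched
neighbor to propose to. In phase `1`, unmatched nodes that do not propose choose a proposal. In
phase `2`, both endpoints of an accepted proposal become matched. -/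
def recv (p : ℕ) (s : NodeState n) (m : Fin n → Option Bool) : NodeState n :=
  match p with
  | 0 => { s with
      dirty := s.affected || (s.dirty && s.label.isNone && decide ((senders m).Nonempty))
      affected := false
      prop := if s.dirty = true ∧ s.label = none ∧ ∀ u, m u = some true → s.id ≤ u
        then least (senders m) else none
      acc := none }
  | 1 => { s with
      affected := false
      acc := if s.label = none ∧ s.prop = none then least (senders m) else none }
  | _ => { s with
      label := s.newLabel m
      dirty := s.affected || (s.dirty && (s.newLabel m).isNone)
      affected := false
      prop := none
      acc := none }

theorem wake_label {ind : Indication n} {s : NodeState n} {u : Fin n} :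
    (s.wake ind).label = some u ↔ s.label = some u ∧ u ∈ ind.nbrs := by
  simp [wake, Option.filter_eq_some_iff]

theorem wake_affected {ind : Indication n} {s : NodeState n} :
    (s.wake ind).affected = true ↔ s.affected = true ∨ ind.edgeIns.Nonempty ∨
      ind.edgeDel.Nonempty ∨ ∃ w ∈ ind.nodeDel, s.label = some w := by
  simp [wake, or_assoc]

theorem mem_senders {m : Fin n → Option Bool} {u : Fin n} : u ∈ senders m ↔ m u ≠ none := by
  simp [senders]

theorem recv_zero_dirty {s : NodeState n} {m : Fin n → Option Bool} :
    (s.recv 0 m).dirty = true ↔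
      s.affected = true ∨ (s.dirty = true ∧ s.label = none ∧ (senders m).Nonempty) := by
  simp [recv, and_assoc]

theorem newLabel_eq_some {s : NodeState n} {m : Fin n → Option Bool} {u : Fin n} :
    s.newLabel m = some u ↔ s.label = some u ∨ (s.label = none ∧
      ((s.acc = some u ∧ u ∈ s.nbrs) ∨ ((∀ w, s.acc = some w → w ∉ s.nbrs) ∧
        s.prop = some u ∧ m u ≠ none))) := by
  simp [newLabel, Option.or_eq_some_iff, Option.filter_eq_some_iff, Option.filter_eq_none_iff,
    Option.isSome_iff_ne_none]

end NodeState

/-- The matching algorithm: epochs of three rounds, given by the clock modulo `3`. -/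
def matchingAlgorithm (n : ℕ) : Algorithm n where
  State := NodeState n
  Msg := Bool
  fintypeMsg := inferInstance
  start := NodeState.start
  fresh := NodeState.fresh
  wake _ := NodeState.wake
  send t := NodeState.send (t % 3)
  recv t := NodeState.recv (t % 3)
  label := NodeState.label
  dirty s := s.dirty = true

/-! ### The invariant, and its behavior under topology changes. -/

section Round

variable {n : ℕ}

open Classical in
/-- The states after the indications of a round. -/
noncomputable def awaken (G H : Network n) (s : Fin n → NodeState n) (v : Fin n) : NodeState n :=
  (if v ∈ G.nodes then s v else NodeState.fresh v).wake (indication G H v)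

open Classical in
/-- The states after the communication of a round, in phase `p`. -/
noncomputable def communicate (p : ℕ) (H : Network n) (t : Fin n → NodeState n) (v : Fin n) :
    NodeState n :=
  (t v).recv p fun u => if H.graph.Adj u v then (t u).send p v else none

/-- The invariant at the end of a round. -/
structure Inv (G : Network n) (s : Fin n → NodeState n) : Prop where
  id : ∀ v, (s v).id = v
  unaffected : ∀ v, (s v).affected = false
  matched : ∀ v ∈ G.nodes, ∀ u, (s v).label = some u → G.graph.Adj v u ∧ (s u).label = some v
  covered : ∀ u v, G.graph.Adj u v → (s u).label = none → (s v).label = none →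
    (s u).dirty = true ∨ (s v).dirty = true
  prop : ∀ v ∈ G.nodes, ∀ u, (s v).prop = some u → (s v).label = none
  acc : ∀ v ∈ G.nodes, ∀ u, (s v).acc = some u → (s v).label = none ∧ (s v).prop = none ∧
    G.graph.Adj v u ∧ (s u).prop = some v

/-- The invariant between the indications and the communication of a round. -/
structure AwakeInv (H : Network n) (t : Fin n → NodeState n) : Prop where
  id : ∀ v, (t v).id = v
  nbrs : ∀ v, (t v).nbrs = H.nbrs v
  matched : ∀ v ∈ H.nodes, ∀ u, (t v).label = some u → H.graph.Adj v u ∧ (t u).label = some v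
  covered : ∀ u v, H.graph.Adj u v → (t u).label = none → (t v).label = none →
    (t u).dirty = true ∨ (t v).dirty = true
  prop : ∀ v ∈ H.nodes, ∀ u, (t v).prop = some u → (t v).label = none
  acc : ∀ v ∈ H.nodes, ∀ u, (t v).acc = some u → (t v).label = none ∧ (t v).prop = none ∧
    (H.graph.Adj v u → (t u).prop = some v)

theorem Network.mem_nbrs {G : Network n} {v u : Fin n} : u ∈ G.nbrs v ↔ G.graph.Adj v u := by
  simp [Network.nbrs]

theorem Network.mem_of_adj_right {G : Network n} {u v : Fin n} (h : G.graph.Adj u v) :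
    v ∈ G.nodes :=
  G.mem_of_adj h.symm

theorem least_eq_some {U : Finset (Fin n)} {u : Fin n} (h : least U = some u) : u ∈ U := by
  unfold least at h
  split_ifs at h with hU
  cases h
  exact U.min'_mem hU

theorem exists_least {U : Finset (Fin n)} (h : U.Nonempty) : ∃ u, least U = some u :=
  ⟨U.min' h, by simp [least, h]⟩

theorem awaken_label (G H : Network n) (s : Fin n → NodeState n) (v u : Fin n) :
    (awaken G H s v).label = some u ↔
      v ∈ G.nodes ∧ (s v).label = some u ∧ H.graph.Adj v u := by
  by_cases hv : v ∈ G.nodes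
  · simp only [awaken, hv, if_true, NodeState.wake_label, indication, Network.mem_nbrs, true_and]
  · simp [awaken, hv, NodeState.wake_label, NodeState.fresh]

theorem awaken_prop (G H : Network n) (s : Fin n → NodeState n) (v u : Fin n) :
    (awaken G H s v).prop = some u ↔ v ∈ G.nodes ∧ (s v).prop = some u := by
  by_cases hv : v ∈ G.nodes <;> simp [awaken, hv, NodeState.wake, NodeState.fresh]

theorem awaken_acc (G H : Network n) (s : Fin n → NodeState n) (v u : Fin n) :
    (awaken G H s v).acc = some u ↔ v ∈ G.nodes ∧ (s v).acc = some u := by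
  by_cases hv : v ∈ G.nodes <;> simp [awaken, hv, NodeState.wake, NodeState.fresh]

theorem awaken_dirty (G H : Network n) (s : Fin n → NodeState n) (v : Fin n) :
    (awaken G H s v).dirty = true ↔
      (v ∈ G.nodes ∧ (s v).dirty = true) ∨ (awaken G H s v).affected = true := by
  by_cases hv : v ∈ G.nodes <;> simp [awaken, hv, NodeState.wake, NodeState.fresh]

/-- The lists `edgeIns` and `edgeDel` together report every changed incident edge, and a fresh node
carries the flag `affected` from the start, so a node detects locally what `Affected` describes
globally. -/
theorem awaken_affected {G H : Network n} {s : Fin n → NodeState n}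
    (hs : ∀ v, (s v).affected = false) {v : Fin n} (hv : v ∈ H.nodes) :
    (awaken G H s v).affected = true ↔ Affected G H (fun v => (s v).label) v := by
  by_cases hG : v ∈ G.nodes
  · have key : (∃ u, EdgeChanged G H v u) ↔
        (∃ u, EdgeChanged G H v u ∧ H.graph.Adj v u) ∨
          (∃ u, EdgeChanged G H v u ∧ G.graph.Adj v u) := by
      constructor
      · rintro ⟨u, hu⟩
        rcases hu.2.2 with h | h
        · exact Or.inr ⟨u, hu, h.1⟩
        · exact Or.inl ⟨u, hu, h.1⟩
      · rintro (⟨u, h, -⟩ | ⟨u, h, -⟩) <;> exact ⟨u, h⟩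
    simp only [Affected, hv, hG, key, awaken, if_true, NodeState.wake_affected]
    simp [hs, indication, Finset.Nonempty, and_assoc, or_assoc]
  · simp [awaken, hG, NodeState.wake, NodeState.fresh, Affected, hv]

theorem AwakeInv.of_inv {G H : Network n} {s : Fin n → NodeState n} (h : Inv G s) :
    AwakeInv H (awaken G H s) where
  id v := by
    by_cases hv : v ∈ G.nodes <;> simp [awaken, hv, NodeState.wake, NodeState.fresh, h.id]
  nbrs v := by simp [awaken, NodeState.wake, indication]
  matched v _ u hu := by
    rw [awaken_label] at hu
    obtain ⟨hv, hl, ha⟩ := hu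
    obtain ⟨h1, h2⟩ := h.matched v hv u hl
    exact ⟨ha, (awaken_label ..).2 ⟨G.mem_of_adj_right h1, h2, ha.symm⟩⟩
  covered := by
    -- A label vanishes only with its edge, which was deleted by itself or with its other endpoint;
    -- either event makes the node affected, hence dirty.
    have lost : ∀ u ∈ H.nodes, (awaken G H s u).label = none →
        (awaken G H s u).dirty = true ∨ (u ∈ G.nodes ∧ (s u).label = none) := by
      intro u hu hl
      by_cases huG : u ∈ G.nodes
      · cases hs : (s u).label with
        | none => exact Or.inr ⟨huG, rfl⟩
        | some w =>
          refine Or.inl ((awaken_dirty ..).2 (Or.inr ((awaken_affected h.unaffected hu).2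
            ⟨hu, Or.inr ?_⟩)))
          have hadj := (h.matched u huG w hs).1
          have hH : ¬ H.graph.Adj u w := fun hH => by
            have := (awaken_label G H s u w).2 ⟨huG, hs, hH⟩
            simp [hl] at this
          by_cases hw : w ∈ H.nodes
          · exact Or.inl ⟨w, ⟨huG, hu⟩, ⟨G.mem_of_adj_right hadj, hw⟩, Or.inl ⟨hadj, hH⟩⟩
          · exact Or.inr ⟨w, hadj, hw, hs⟩
      · exact Or.inl ((awaken_dirty ..).2 (Or.inr ((awaken_affected h.unaffected hu).2
          ⟨hu, Or.inl huG⟩)))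
    intro u v ha hlu hlv
    have hu := H.mem_of_adj ha
    have hv := H.mem_of_adj_right ha
    rcases lost u hu hlu with hd | ⟨huG, hu0⟩
    · exact Or.inl hd
    rcases lost v hv hlv with hd | ⟨hvG, hv0⟩
    · exact Or.inr hd
    by_cases hG : G.graph.Adj u v
    · rcases h.covered u v hG hu0 hv0 with hd | hd
      · exact Or.inl ((awaken_dirty ..).2 (Or.inl ⟨huG, hd⟩))
      · exact Or.inr ((awaken_dirty ..).2 (Or.inl ⟨hvG, hd⟩))
    · exact Or.inl ((awaken_dirty ..).2 (Or.inr ((awaken_affected h.unaffected hu).2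
        ⟨hu, Or.inr (Or.inl ⟨v, ⟨huG, hu⟩, ⟨hvG, hv⟩, Or.inr ⟨ha, hG⟩⟩)⟩)))
  prop v _ u hu := by
    rw [awaken_prop] at hu
    have := h.prop v hu.1 u hu.2
    rw [Option.eq_none_iff_forall_ne_some]
    intro w hw
    rw [awaken_label] at hw
    simp [this] at hw
  acc v _ u hu := by
    rw [awaken_acc] at hu
    obtain ⟨h1, h2, h3, h4⟩ := h.acc v hu.1 u hu.2
    refine ⟨?_, ?_, fun _ => (awaken_prop ..).2 ⟨G.mem_of_adj_right h3, h4⟩⟩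
    · rw [Option.eq_none_iff_forall_ne_some]
      intro w hw
      rw [awaken_label] at hw
      simp [h1] at hw
    · rw [Option.eq_none_iff_forall_ne_some]
      intro w hw
      rw [awaken_prop] at hw
      simp [h2] at hw

/-! ### The effect of communication in each phase. -/

theorem mem_senders_phase_zero {H : Network n} {t : Fin n → NodeState n} {v u : Fin n} :
    (open Classical in u ∈ NodeState.senders
      fun u => if H.graph.Adj u v then (t u).send 0 v else none) ↔
      H.graph.Adj v u ∧ (t u).label = none := by
  rw [NodeState.mem_senders]
  simp [NodeState.send, H.graph.adj_comm u v]

theorem mem_senders_phase_one {H : Network n} {t : Fin n → NodeState n} {v u : Fin n} :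
    (open Classical in u ∈ NodeState.senders
      fun u => if H.graph.Adj u v then (t u).send 1 v else none) ↔
      H.graph.Adj v u ∧ (t u).prop = some v := by
  rw [NodeState.mem_senders]
  simp [NodeState.send, H.graph.adj_comm u v]

theorem communicate_zero_dirty {H : Network n} {t : Fin n → NodeState n} {v : Fin n} :
    (communicate 0 H t v).dirty = true ↔ (t v).affected = true ∨
      ((t v).dirty = true ∧ (t v).label = none ∧
        ∃ u, H.graph.Adj v u ∧ (t u).label = none) := by
  simp only [communicate, NodeState.recv_zero_dirty, Finset.Nonempty, mem_senders_phase_zero]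

theorem communicate_zero_prop {H : Network n} {t : Fin n → NodeState n} {v u : Fin n}
    (h : (communicate 0 H t v).prop = some u) :
    (t v).dirty = true ∧ (t v).label = none ∧ H.graph.Adj v u ∧ (t u).label = none ∧
      ∀ w, H.graph.Adj v w → (t w).label = none → (t w).dirty = true → (t v).id ≤ w := by
  simp only [communicate, NodeState.recv] at h
  split_ifs at h with hc
  obtain ⟨h1, h2, h3⟩ := hc
  have := mem_senders_phase_zero.1 (least_eq_some h)
  refine ⟨h1, h2, this.1, this.2, fun w hw hl hd => h3 w ?_⟩
  simp [hw.symm, NodeState.send, hl, hd]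

theorem exists_communicate_zero_prop {H : Network n} {t : Fin n → NodeState n} {v : Fin n}
    (hd : (t v).dirty = true) (hl : (t v).label = none)
    (hu : ∃ u, H.graph.Adj v u ∧ (t u).label = none)
    (hmin : ∀ w, (t w).dirty = true → H.graph.Adj v w → (t v).id ≤ w) :
    ∃ u, (communicate 0 H t v).prop = some u := by
  obtain ⟨u, hu⟩ := hu
  obtain ⟨w, hw⟩ := exists_least ⟨u, mem_senders_phase_zero.2 hu⟩
  refine ⟨w, ?_⟩
  simp only [communicate, NodeState.recv]
  rw [if_pos, hw]
  refine ⟨hd, hl, fun x hx => ?_⟩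
  split_ifs at hx with ha
  simp only [NodeState.send] at hx
  split_ifs at hx
  exact hmin x (by simpa using hx) ha.symm

theorem communicate_one_acc {H : Network n} {t : Fin n → NodeState n} {v u : Fin n}
    (h : (communicate 1 H t v).acc = some u) :
    (t v).label = none ∧ (t v).prop = none ∧ H.graph.Adj v u ∧ (t u).prop = some v := by
  simp only [communicate, NodeState.recv] at h
  split_ifs at h with hc
  exact ⟨hc.1, hc.2, mem_senders_phase_one.1 (least_eq_some h)⟩

theorem exists_communicate_one_acc {H : Network n} {t : Fin n → NodeState n} {v u : Fin n}
    (hl : (t v).label = none) (hp : (t v).prop = none) (ha : H.graph.Adj v u)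
    (hu : (t u).prop = some v) : ∃ w, (communicate 1 H t v).acc = some w := by
  obtain ⟨w, hw⟩ := exists_least ⟨u, mem_senders_phase_one.2 ⟨ha, hu⟩⟩
  refine ⟨w, ?_⟩
  simp only [communicate, NodeState.recv]
  rw [if_pos ⟨hl, hp⟩, hw]

/-- Losing the edge after acceptance is harmless: the acceptor consults its neighbor list and the
proposer waits for a message, and both tests amount to adjacency in `H`. This makes the right-hand
side symmetric in `u` and `v`. -/
theorem communicate_two_label {H : Network n} {t : Fin n → NodeState n} (h : AwakeInv H t)
    {v : Fin n} (hv : v ∈ H.nodes) (u : Fin n) :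
    (communicate 2 H t v).label = some u ↔ (t v).label = some u ∨
      (H.graph.Adj v u ∧ ((t v).acc = some u ∨ (t u).acc = some v)) := by
  have e : (communicate 2 H t v).label = some u ↔ (t v).label = some u ∨
      ((t v).label = none ∧ (((t v).acc = some u ∧ H.graph.Adj v u) ∨
        ((∀ w, (t v).acc = some w → ¬ H.graph.Adj v w) ∧
          (t v).prop = some u ∧ H.graph.Adj v u ∧ (t u).acc = some v))) := by
    simp only [communicate, NodeState.recv, NodeState.newLabel_eq_some, h.nbrs, Network.mem_nbrs]
    simp [NodeState.send, H.graph.adj_comm u v]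
  rw [e]
  constructor
  · rintro (h1 | ⟨-, ⟨h1, h2⟩ | ⟨-, -, h2, h3⟩⟩)
    · exact Or.inl h1
    · exact Or.inr ⟨h2, Or.inl h1⟩
    · exact Or.inr ⟨h2, Or.inr h3⟩
  · rintro (h1 | ⟨h2, h1 | h1⟩)
    · exact Or.inl h1
    · exact Or.inr ⟨(h.acc v hv u h1).1, Or.inl ⟨h1, h2⟩⟩
    · have hp := (h.acc u (H.mem_of_adj_right h2) v h1).2.2 h2.symm
      refine Or.inr ⟨h.prop v hv u hp, Or.inr ⟨fun w hw => ?_, hp, h2, h1⟩⟩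
      have := (h.acc v hv w hw).2.1
      simp [hp] at this

theorem communicate_two_dirty {H : Network n} {t : Fin n → NodeState n} {v : Fin n} :
    (communicate 2 H t v).dirty = true ↔ (t v).affected = true ∨
      ((t v).dirty = true ∧ (communicate 2 H t v).label = none) := by
  simp [communicate, NodeState.recv]

theorem communicate_id (p : ℕ) (H : Network n) (t : Fin n → NodeState n) (v : Fin n) :
    (communicate p H t v).id = (t v).id := by
  unfold communicate NodeState.recv
  split <;> rfl

theorem communicate_affected (p : ℕ) (H : Network n) (t : Fin n → NodeState n) (v : Fin n) :
    (communicate p H t v).affected = false := by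
  unfold communicate NodeState.recv
  split <;> rfl

theorem dirty_of_communicate_dirty {p : ℕ} {H : Network n} {t : Fin n → NodeState n} {v : Fin n}
    (h : (communicate p H t v).dirty = true) : (t v).dirty = true ∨ (t v).affected = true := by
  unfold communicate NodeState.recv at h
  split at h <;> simp at h <;> tauto

theorem communicate_dirty_of_affected {p : ℕ} {H : Network n} {t : Fin n → NodeState n}
    {v : Fin n} (h : (t v).affected = true) (hd : (t v).dirty = true) :
    (communicate p H t v).dirty = true := by
  unfold communicate NodeState.recv
  split <;> simp [h, hd]

/-! ### Preservation of the invariant. -/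

theorem Inv.communicate_zero {H : Network n} {t : Fin n → NodeState n} (h : AwakeInv H t) :
    Inv H (communicate 0 H t) where
  id v := (communicate_id ..).trans (h.id v)
  unaffected _ := communicate_affected ..
  matched := h.matched
  covered u v ha hu hv := by
    -- Each endpoint sees the other as an unmatched neighbor, so the dirty one is not cleaned.
    rcases h.covered u v ha hu hv with hd | hd
    · exact Or.inl (communicate_zero_dirty.2 (Or.inr ⟨hd, hu, v, ha, hv⟩))
    · exact Or.inr (communicate_zero_dirty.2 (Or.inr ⟨hd, hv, u, ha.symm, hu⟩))
  prop v _ u hu := (communicate_zero_prop hu).2.1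
  acc v _ u hu := by simp [communicate, NodeState.recv] at hu

theorem Inv.communicate_one {H : Network n} {t : Fin n → NodeState n} (h : AwakeInv H t) :
    Inv H (communicate 1 H t) where
  id v := (communicate_id ..).trans (h.id v)
  unaffected _ := communicate_affected ..
  matched := h.matched
  covered := h.covered
  prop := h.prop
  acc _ _ _ hu := communicate_one_acc hu

theorem Inv.communicate_two {H : Network n} {t : Fin n → NodeState n} (h : AwakeInv H t) :
    Inv H (communicate 2 H t) where
  id v := (communicate_id ..).trans (h.id v)
  unaffected _ := communicate_affected ..
  matched v hv u hu := by
    rw [communicate_two_label h hv] at hu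
    rcases hu with hu | ⟨ha, hu⟩
    · obtain ⟨ha, hl⟩ := h.matched v hv u hu
      exact ⟨ha, (communicate_two_label h (H.mem_of_adj_right ha) v).2 (Or.inl hl)⟩
    · exact ⟨ha, (communicate_two_label h (H.mem_of_adj_right ha) v).2
        (Or.inr ⟨ha.symm, hu.symm⟩)⟩
  covered u v ha hu hv := by
    -- Labels are only gained in this phase, so the edge was already unmatched at both ends; its
    -- dirty endpoint is still unmatched and stays dirty.
    have old : ∀ w ∈ H.nodes, (communicate 2 H t w).label = none → (t w).label = none := by
      intro w hw hl
      rw [Option.eq_none_iff_forall_ne_some]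
      intro x hx
      have := (communicate_two_label h hw x).2 (Or.inl hx)
      simp [hl] at this
    rcases h.covered u v ha (old u (H.mem_of_adj ha) hu) (old v (H.mem_of_adj_right ha) hv)
      with hd | hd
    · exact Or.inl (communicate_two_dirty.2 (Or.inr ⟨hd, hu⟩))
    · exact Or.inr (communicate_two_dirty.2 (Or.inr ⟨hd, hv⟩))
  prop v _ u hu := by simp [communicate, NodeState.recv] at hu
  acc v _ u hu := by simp [communicate, NodeState.recv] at hu

theorem Inv.round {p : ℕ} (hp : p < 3) {G H : Network n} {s : Fin n → NodeState n}
    (h : Inv G s) : Inv H (communicate p H (awaken G H s)) := by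
  have h' : AwakeInv H (awaken G H s) := .of_inv h
  interval_cases p
  exacts [.communicate_zero h', .communicate_one h', .communicate_two h']

/-- The matching clauses hold whether or not nodes are dirty; cleanliness matters only for
maximality. -/
theorem Inv.starConsistent {G : Network n} {s : Fin n → NodeState n} (h : Inv G s) {v : Fin n}
    (hv : v ∈ G.nodes) (hd : ¬ (s v).dirty = true)
    (hn : ∀ u, G.graph.Adj v u → ¬ (s u).dirty = true) :
    StarConsistent G (fun v => (s v).label) v := by
  refine ⟨fun u hu => (h.matched v hv u hu).1, fun u ha => ?_, fun hl u ha hu => ?_⟩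
  · exact ⟨fun hl => (h.matched v hv u hl).2, fun hl => (h.matched u (G.mem_of_adj_right ha) v hl).2⟩
  · rcases h.covered v u ha hl hu with h' | h'
    exacts [hd h', hn u ha h']

/-! ### Progress in an epoch without changes. -/

theorem affected_false_of_eq {G : Network n} {L : Fin n → Label n} {v : Fin n} :
    ¬ Affected G G L v := by
  rintro ⟨h1, h2 | ⟨u, h2⟩ | ⟨w, h2, h3, -⟩⟩
  · exact h2 h1
  · rcases h2.2.2 with h | h <;> exact h.2 h.1
  · exact h3 (G.mem_of_adj_right h2)

/-- In a round without topology changes, the indications change only the list of neighbors. -/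
theorem awaken_self {G : Network n} {s : Fin n → NodeState n} (h : Inv G s) {v : Fin n}
    (hv : v ∈ G.nodes) : awaken G G s v = { s v with nbrs := G.nbrs v } := by
  have ha : (awaken G G s v).affected = false := by
    rw [← Bool.not_eq_true, awaken_affected h.unaffected hv]
    exact affected_false_of_eq
  have hl : (awaken G G s v).label = (s v).label := by
    refine Option.ext fun u => ?_
    rw [awaken_label]
    exact ⟨fun h' => h'.2.1, fun h' => ⟨hv, h', (h.matched v hv u h').1⟩⟩
  have hd : (awaken G G s v).dirty = (s v).dirty := by
    rw [Bool.eq_iff_iff, awaken_dirty]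
    simp [ha, hv]
  have hp : awaken G G s v = ⟨(s v).id, G.nbrs v, (awaken G G s v).label,
      (awaken G G s v).dirty, (awaken G G s v).affected, (s v).prop, (s v).acc⟩ := by
    simp [awaken, hv, NodeState.wake, indication]
  rw [hp, ha, hl, hd, ← h.unaffected v]

/-- An epoch without topology changes cleans a node. -/
theorem exists_cleaned {G : Network n} {s s₁ s₂ s₃ : Fin n → NodeState n} (h : Inv G s)
    (h₁ : s₁ = communicate 0 G (awaken G G s)) (h₂ : s₂ = communicate 1 G (awaken G G s₁))
    (h₃ : s₃ = communicate 2 G (awaken G G s₂)) (hD : ∃ v ∈ G.nodes, (s v).dirty = true) :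
    ∃ v ∈ G.nodes, (s v).dirty = true ∧ ¬ (s₃ v).dirty = true := by
  have i₁ : Inv G s₁ := h₁ ▸ h.round (by norm_num)
  have i₂ : Inv G s₂ := h₂ ▸ i₁.round (by norm_num)
  have w₀ := fun v hv => awaken_self h (v := v) hv
  have w₁ := fun v hv => awaken_self i₁ (v := v) hv
  have w₂ := fun v hv => awaken_self i₂ (v := v) hv
  by_contra! hcon
  -- Without changes no node becomes dirty, so a node that is dirty after the epoch was dirty after
  -- each of its rounds.
  have hmono₁ : ∀ v ∈ G.nodes, (s v).dirty = true → (s₁ v).dirty = true := by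
    intro v hv hd
    have hd3 := hcon v hv hd
    rw [h₃] at hd3
    have hd2 := dirty_of_communicate_dirty hd3
    simp only [w₂ v hv, i₂.unaffected, Bool.false_eq_true, or_false] at hd2
    rw [h₂] at hd2
    have hd1 := dirty_of_communicate_dirty hd2
    simpa only [w₁ v hv, i₁.unaffected, Bool.false_eq_true, or_false] using hd1
  -- The dirty node of least identifier passes every local minimality test.
  obtain ⟨v, hvm, hmin⟩ := Finset.exists_minimal
    (s := G.nodes.filter fun v => (s v).dirty = true) (by simpa [Finset.Nonempty] using hD)
  simp only [Finset.mem_filter] at hvm hmin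
  obtain ⟨hv, hvd⟩ := hvm
  have hle : ∀ w ∈ G.nodes, (s w).dirty = true → v ≤ w := fun w hw hd =>
    (le_total v w).elim id fun hwv => hmin ⟨hw, hd⟩ hwv
  have hd1 := hmono₁ v hv hvd
  rw [h₁, communicate_zero_dirty] at hd1
  simp only [w₀ v hv, h.unaffected, Bool.false_eq_true, false_or] at hd1
  obtain ⟨-, hvl, hu⟩ := hd1
  obtain ⟨u, hp⟩ := exists_communicate_zero_prop (H := G) (t := awaken G G s) (v := v)
    (by simpa only [w₀ v hv] using hvd) (by simpa only [w₀ v hv] using hvl) hu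
    (fun w hd ha => by
      have hw := G.mem_of_adj_right ha
      simp only [w₀ v hv, w₀ w hw, h.id] at hd ⊢
      exact hle w hw hd)
  obtain ⟨-, -, hvu, hul, -⟩ := communicate_zero_prop hp
  have hun := G.mem_of_adj_right hvu
  -- If `u` proposed, it would be dirty and satisfy `u ≤ v`, while minimality of `v` gives `v ≤ u`.
  have hup : (s₁ u).prop = none := by
    rw [Option.eq_none_iff_forall_ne_some]
    intro x hx
    rw [h₁] at hx
    obtain ⟨hud, -, -, -, hall⟩ := communicate_zero_prop hx
    have h1 := hall v hvu.symm (by simpa only [w₀ v hv] using hvl)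
      (by simpa only [w₀ v hv] using hvd)
    simp only [w₀ u hun, h.id] at h1 hud
    exact hvu.ne ((hle u hun hud).antisymm h1)
  have hul1 : (s₁ u).label = none := by rw [h₁]; exact hul
  rw [← h₁] at hp
  -- The accepted proposer `x` may differ from `v`, but proposers are dirty, so cleaning `x` is
  -- enough.
  obtain ⟨x, hx⟩ := exists_communicate_one_acc (H := G) (t := awaken G G s₁) (v := u) (u := v)
    (by simpa only [w₁ u hun] using hul1) (by simpa only [w₁ u hun] using hup) hvu.symm
    (by simpa only [w₁ v hv] using hp)
  rw [← h₂] at hx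
  obtain ⟨-, -, hux, hxp⟩ := i₂.acc u hun x hx
  have hxn := G.mem_of_adj_right hux
  have hxp1 : (s₁ x).prop = some u := by
    have e : (s₂ x).prop = (awaken G G s₁ x).prop := by rw [h₂]; rfl
    rw [e, w₁ x hxn] at hxp
    exact hxp
  rw [h₁] at hxp1
  have hxd := (communicate_zero_prop hxp1).1
  simp only [w₀ x hxn] at hxd
  have hd3 := hcon x hxn hxd
  rw [h₃, communicate_two_dirty] at hd3
  simp only [w₂ x hxn, i₂.unaffected, Bool.false_eq_true, false_or] at hd3
  have hl3 := (communicate_two_label (AwakeInv.of_inv (H := G) i₂) hxn u).2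
    (Or.inr ⟨hux.symm, Or.inr (by simpa only [w₂ u hun] using hx)⟩)
  simp [hd3.2] at hl3

end Round

/-! ### Counting topology changes and amortization. -/

section Changes

variable {n : ℕ}

theorem eq_of_numChanges_eq_zero {G H : Network n} (h : numChanges G H = 0) : G = H := by
  simp only [numChanges, Nat.add_eq_zero_iff, Finset.card_eq_zero, Finset.sdiff_eq_empty_iff_subset,
    Finset.filter_eq_empty_iff, Finset.mem_univ, true_imp_iff] at h
  obtain ⟨⟨h1, h2⟩, h3⟩ := h
  have hn : G.nodes = H.nodes := h2.antisymm h1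
  have hg : G.graph = H.graph := by
    ext u v
    by_contra hne
    have hor : Xor (G.graph.Adj u v) (H.graph.Adj u v) := by
      rw [xor_iff_not_iff]; exact hne
    have hu : u ∈ G.nodes := hor.elim (fun h => G.mem_of_adj h.1) fun h => h1 (H.mem_of_adj h.1)
    have hv : v ∈ G.nodes := hor.elim (fun h => G.mem_of_adj_right h.1)
      fun h => h1 (H.mem_of_adj_right h.1)
    exact h3 ⟨u, v, rfl, ⟨hu, h2 hu⟩, ⟨hv, h2 hv⟩, hor⟩
  cases G; cases H; cases hn; cases hg; rfl

-- An inserted node accounts for itself, a changed edge for its two endpoints, and a deleted node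
-- for its former partner, unique because `L` is symmetric.
open Classical in
theorem card_affected_le {G H : Network n} {L : Fin n → Label n}
    (hL : ∀ v ∈ G.nodes, ∀ u, L v = some u → L u = some v) :
    (Finset.univ.filter fun v => Affected G H L v).card ≤ 2 * numChanges G H := by
  set E := Finset.univ.filter fun e : Sym2 (Fin n) => ∃ u v, e = s(u, v) ∧ EdgeChanged G H u v
    with hE
  set M := Finset.univ.filter fun v => ∃ w, G.graph.Adj v w ∧ w ∉ H.nodes ∧ L v = some w with hM
  have hsub : (Finset.univ.filter fun v => Affected G H L v) ⊆
      (H.nodes \ G.nodes) ∪ M ∪ E.biUnion Sym2.toFinset := by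
    intro v hv
    simp only [Finset.mem_filter, Finset.mem_univ, true_and] at hv
    simp only [Finset.mem_union, Finset.mem_sdiff, Finset.mem_biUnion, Sym2.mem_toFinset]
    obtain ⟨h1, h2 | ⟨u, h2⟩ | h2⟩ := hv
    · exact Or.inl (Or.inl ⟨h1, h2⟩)
    · exact Or.inr ⟨s(v, u), by simp only [hE, Finset.mem_filter, Finset.mem_univ, true_and]
                                exact ⟨v, u, rfl, h2⟩, Sym2.mem_mk_left v u⟩
    · exact Or.inl (Or.inr (by simpa [hM] using h2))
  -- The map `L` sends each abandoned node to its deleted partner, and symmetry makes it injective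
  -- there.
  have hMc : M.card ≤ (G.nodes \ H.nodes).card := by
    have : (M.image L).card = M.card := by
      apply Finset.card_image_of_injOn
      intro a ha b hb hab
      simp only [hM, Finset.coe_filter, Finset.mem_univ, true_and, Set.mem_ofPred_eq] at ha hb
      obtain ⟨w, haw, -, hw⟩ := ha
      obtain ⟨w', hbw, -, hw'⟩ := hb
      have e1 := hL a (G.mem_of_adj haw) w hw
      have e2 := hL b (G.mem_of_adj hbw) w (by rw [← hab, hw])
      rw [e1] at e2
      exact Option.some.inj e2
    rw [← this, ← Finset.card_image_of_injective (G.nodes \ H.nodes) (Option.some_injective _)]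
    apply Finset.card_le_card
    intro l hl
    simp only [hM, Finset.mem_image, Finset.mem_filter, Finset.mem_univ, true_and,
      Finset.mem_sdiff] at hl ⊢
    obtain ⟨v, ⟨w, h1, h2, h3⟩, rfl⟩ := hl
    exact ⟨w, ⟨G.mem_of_adj_right h1, h2⟩, h3.symm⟩
  have hEc : (E.biUnion Sym2.toFinset).card ≤ E.card * 2 := by
    apply Finset.card_biUnion_le_card_mul
    intro e _
    rw [Sym2.card_toFinset]
    split_ifs <;> norm_num
  have := Finset.card_le_card hsub
  have := Finset.card_union_le ((H.nodes \ G.nodes) ∪ M) (E.biUnion Sym2.toFinset)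
  have := Finset.card_union_le (H.nodes \ G.nodes) M
  simp only [numChanges, ← hE]
  omega

/-- If every change adds at most two units of work to `d` and every epoch of three rounds without
changes reduces the work, then there is work in at most `9` rounds per change. -/
theorem card_pos_le (d c : ℕ → ℕ) (h0 : d 0 = 0) (hstep : ∀ i, d (i + 1) ≤ d i + 2 * c i)
    (hquiet : ∀ q, 0 < d (3 * q + 2) → c (3 * q + 2) = 0 → c (3 * q + 3) = 0 →
      c (3 * q + 4) = 0 → d (3 * q + 5) < d (3 * q + 2)) (i : ℕ) :
    ((Finset.range (i + 1)).filter fun r => 0 < d r).card ≤ 9 * ∑ r ∈ Finset.range i, c r := by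
  set N : ℕ → ℕ := fun i => ((Finset.range (i + 1)).filter fun r => 0 < d r).card with hN
  set C : ℕ → ℕ := fun i => ∑ r ∈ Finset.range i, c r with hC
  have hN0 : N 0 = 0 := by simp [hN, Finset.filter_singleton, h0]
  have hC0 : C 0 = 0 := by simp [hC]
  have hCs : ∀ i, C (i + 1) = C i + c i := fun i => Finset.sum_range_succ _ _
  have hNs : ∀ i, N (i + 1) ≤ N i + 1 ∧ (d (i + 1) = 0 → N (i + 1) = N i) := by
    intro i
    simp only [hN]
    rw [Finset.range_add_one (n := i + 1), Finset.filter_insert]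
    split_ifs with h
    · exact ⟨Finset.card_insert_le _ _, fun h' => by omega⟩
    · exact ⟨by omega, fun _ => rfl⟩
  -- Epochs end at rounds `3 * q + 2`. A quiet epoch with work adds at most three to `N` and removes
  -- at least three from `3 * d`.
  have main : ∀ q, N (3 * q + 2) + 3 * d (3 * q + 2) ≤ 9 * C (3 * q + 2) := by
    intro q
    induction q with
    | zero =>
      have a1 := hstep 0
      have a2 := hstep 1
      have b1 := hNs 0
      have b2 := hNs 1
      have c1 := hCs 0
      have c2 := hCs 1
      norm_num at *
      omega
    | succ q ih =>
      have a1 := hstep (3 * q + 2)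
      have a2 := hstep (3 * q + 3)
      have a3 := hstep (3 * q + 4)
      have b1 := hNs (3 * q + 2)
      have b2 := hNs (3 * q + 3)
      have b3 := hNs (3 * q + 4)
      have c1 := hCs (3 * q + 2)
      have c2 := hCs (3 * q + 3)
      have c3 := hCs (3 * q + 4)
      have hq := hquiet q
      simp only [show 3 * (q + 1) + 2 = 3 * q + 5 by ring]
      simp only [add_assoc, Nat.reduceAdd] at *
      omega
  change N i ≤ 9 * C i
  -- Within an unfinished epoch, the at most two extra rounds are paid for by the term `3 * d` at
  -- the last boundary, or by a change since then if that term is zero.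
  have hcases : i = 0 ∨ i = 1 ∨ ∃ q, i = 3 * q + 2 ∨ i = 3 * q + 3 ∨ i = 3 * q + 4 := by
    by_cases h : i < 2
    · omega
    · exact Or.inr (Or.inr ⟨(i - 2) / 3, by omega⟩)
  rcases hcases with rfl | rfl | ⟨q, hq⟩
  · omega
  · have a1 := hstep 0
    have b1 := hNs 0
    have c1 := hCs 0
    norm_num at *
    omega
  · have ih := main q
    have a1 := hstep (3 * q + 2)
    have a2 := hstep (3 * q + 3)
    have b1 := hNs (3 * q + 2)
    have b2 := hNs (3 * q + 3)
    have c1 := hCs (3 * q + 2)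
    have c2 := hCs (3 * q + 3)
    simp only [add_assoc, Nat.reduceAdd] at *
    rcases hq with rfl | rfl | rfl <;> omega

end Changes

/-! ### Executions of the algorithm. -/

section Main

variable {n : ℕ} (G : ℕ → Network n) (L₀ : Fin n → Label n)

/-- The states of the matching algorithm. -/
noncomputable abbrev run : ℕ → Fin n → NodeState n :=
  (matchingAlgorithm n).state G L₀

/-- As `3` divides `15 * n`, the wrap-around of the clock never cuts an epoch. -/
theorem clock_mod_three (n i : ℕ) : clock n i % 3 = i % 3 :=
  Nat.mod_mod_of_dvd _ ⟨5 * n, by ring⟩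

theorem run_succ (i : ℕ) : run G L₀ (i + 1) =
    communicate ((i + 1) % 3) (G (i + 1)) (awaken (G i) (G (i + 1)) (run G L₀ i)) := by
  rw [← clock_mod_three n (i + 1)]
  rfl

variable {L₀}

theorem inv_run (h : Legal (G 0) L₀) (i : ℕ) : Inv (G i) (run G L₀ i) := by
  induction i with
  | zero =>
    have hl : ∀ v, (run G L₀ 0 v).label = L₀ v := fun v => rfl
    refine ⟨fun v => rfl, fun v => rfl, fun v hv u hu => ?_, fun u v ha hu hv => ?_,
      fun v _ u hu => ?_, fun v _ u hu => ?_⟩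
    · rw [hl] at hu ⊢
      have ha := (h v hv).1 u hu
      exact ⟨ha, ((h v hv).2.1 u ha).1 hu⟩
    · exact absurd hv ((h u ((G 0).mem_of_adj ha)).2.2 hu v ha)
    · cases hu
    · cases hu
  | succ i ih =>
    rw [run_succ]
    exact ih.round (Nat.mod_lt _ (by norm_num))

theorem isDirty_of_affected (h : Legal (G 0) L₀) {i : ℕ} {v : Fin n}
    (ha : Affected (G i) (G (i + 1)) ((matchingAlgorithm n).labels G L₀ i) v) :
    (matchingAlgorithm n).IsDirty G L₀ (i + 1) v := by
  refine ⟨ha.1, ?_⟩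
  change (run G L₀ (i + 1) v).dirty = true
  have h' := (awaken_affected (inv_run G h i).unaffected ha.1).2 ha
  rw [run_succ]
  exact communicate_dirty_of_affected h' ((awaken_dirty ..).2 (Or.inr h'))

theorem isDirty_or_affected (h : Legal (G 0) L₀) {i : ℕ} {v : Fin n}
    (hd : (matchingAlgorithm n).IsDirty G L₀ (i + 1) v) :
    (matchingAlgorithm n).IsDirty G L₀ i v ∨
      Affected (G i) (G (i + 1)) ((matchingAlgorithm n).labels G L₀ i) v := by
  obtain ⟨hv, hd⟩ := hd
  change (run G L₀ (i + 1) v).dirty = true at hd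
  rw [run_succ] at hd
  rcases dirty_of_communicate_dirty hd with h' | h'
  · rcases (awaken_dirty ..).1 h' with h' | h'
    · exact Or.inl h'
    · exact Or.inr ((awaken_affected (inv_run G h i).unaffected hv).1 h')
  · exact Or.inr ((awaken_affected (inv_run G h i).unaffected hv).1 h')

theorem starConsistent_of_clean (h : Legal (G 0) L₀) {i : ℕ} {v : Fin n} (hv : v ∈ (G i).nodes)
    (hd : ¬ (matchingAlgorithm n).IsDirty G L₀ i v)
    (hn : ∀ u, (G i).graph.Adj v u → ¬ (matchingAlgorithm n).IsDirty G L₀ i u) :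
    StarConsistent (G i) ((matchingAlgorithm n).labels G L₀ i) v :=
  (inv_run G h i).starConsistent hv (fun hd' => hd ⟨hv, hd'⟩)
    fun u ha hd' => hn u ha ⟨(G i).mem_of_adj_right ha, hd'⟩

theorem incorrect_le_dirtyRounds (h : Legal (G 0) L₀) (i : ℕ) :
    (matchingAlgorithm n).incorrect G L₀ i ≤ (matchingAlgorithm n).dirtyRounds G L₀ i := by
  classical
  apply Finset.card_le_card
  apply Finset.monotone_filter_right
  rintro r - ⟨v, hv, hc⟩
  by_contra! hcl
  exact hc (starConsistent_of_clean G h hv (hcl v) fun u _ => hcl u)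

open Classical in
theorem dirtyRounds_le (h : Legal (G 0) L₀) (i : ℕ) :
    (matchingAlgorithm n).dirtyRounds G L₀ i ≤ 9 * changes G i := by
  set D : ℕ → Finset (Fin n) := fun i =>
    Finset.univ.filter fun v => (matchingAlgorithm n).IsDirty G L₀ i v with hD
  have mem : ∀ i v, v ∈ D i ↔ (matchingAlgorithm n).IsDirty G L₀ i v := by simp [hD]
  have key := card_pos_le (fun i => (D i).card) (fun i => numChanges (G i) (G (i + 1))) ?_ ?_ ?_ i
  · refine le_trans ?_ key
    apply Finset.card_le_card
    apply Finset.monotone_filter_right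
    rintro r - ⟨v, hv⟩
    exact Finset.card_pos.2 ⟨v, (mem r v).2 hv⟩
  · simp only [Finset.card_eq_zero, Finset.eq_empty_iff_forall_notMem, mem]
    rintro v ⟨-, hv⟩
    cases hv
  · intro i
    have hsub : D (i + 1) ⊆ D i ∪ Finset.univ.filter fun v =>
        Affected (G i) (G (i + 1)) ((matchingAlgorithm n).labels G L₀ i) v := by
      intro v hv
      simp only [Finset.mem_union, mem, Finset.mem_filter, Finset.mem_univ, true_and] at hv ⊢
      exact isDirty_or_affected G h hv
    have h1 := Finset.card_le_card hsub
    have h2 := Finset.card_union_le (D i) (Finset.univ.filter fun v =>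
      Affected (G i) (G (i + 1)) ((matchingAlgorithm n).labels G L₀ i) v)
    have h3 := card_affected_le (H := G (i + 1)) (L := (matchingAlgorithm n).labels G L₀ i)
      fun v hv u hu => ((inv_run G h i).matched v hv u hu).2
    exact h1.trans (h2.trans (Nat.add_le_add_left h3 _))
  · intro q hpos c1 c2 c3
    have e1 := eq_of_numChanges_eq_zero c1
    have e2 := eq_of_numChanges_eq_zero c2
    have e3 := eq_of_numChanges_eq_zero c3
    have mono : ∀ i, G i = G (i + 1) → D (i + 1) ⊆ D i := by
      intro i e v hv
      rw [mem] at hv ⊢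
      refine (isDirty_or_affected G h hv).resolve_right ?_
      rw [← e]
      exact affected_false_of_eq
    have m : D (3 * q + 5) ⊆ D (3 * q + 2) := ((mono _ e3).trans (mono _ e2)).trans (mono _ e1)
    have r1 := run_succ G L₀ (3 * q + 2)
    have r2 := run_succ G L₀ (3 * q + 3)
    have r3 := run_succ G L₀ (3 * q + 4)
    -- All networks of the quiet epoch are identified with `G (3 * q + 2)`, and its rounds run
    -- phases `0`, `1`, `2`.
    rw [show (3 * q + 2 + 1) % 3 = 0 by omega, ← e1] at r1
    rw [show (3 * q + 3 + 1) % 3 = 1 by omega, ← e2, ← show _ = G (3 * q + 3) from e1] at r2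
    rw [show (3 * q + 4 + 1) % 3 = 2 by omega, ← e3, ← show _ = G (3 * q + 4) from e2,
      ← show _ = G (3 * q + 3) from e1] at r3
    obtain ⟨v, hv⟩ := Finset.card_pos.1 hpos
    obtain ⟨x, hx, hxd, hxc⟩ := exists_cleaned (inv_run G h (3 * q + 2)) r1 r2 r3
      ⟨v, (mem _ _).1 hv⟩
    refine Finset.card_lt_card (Finset.ssubset_iff_subset_ne.2 ⟨m, fun heq => hxc ?_⟩)
    have : x ∈ D (3 * q + 5) := heq ▸ (mem _ _).2 ⟨hx, hxd⟩
    exact ((mem _ _).1 this).2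

end Main

end DynMM

theorem mainTheorem7 :
    ∃ k c : ℕ, ∀ n : ℕ, ∃ A : DynMM.Algorithm n,
      -- messages of `O(log n)` bits
      Fintype.card A.Msg ≤ 2 ^ (c * (Nat.log 2 n + 1)) ∧
      ∀ (G : ℕ → DynMM.Network n) (L₀ : Fin n → DynMM.Label n), DynMM.Legal (G 0) L₀ →
        -- the nodes start with the given labels, and no node is dirty
        (∀ v ∈ (G 0).nodes, A.labels G L₀ 0 v = L₀ v ∧ ¬ A.IsDirty G L₀ 0 v) ∧
        -- amortized round complexity at most `k`
        (∀ i, A.incorrect G L₀ i ≤ k * DynMM.changes G i) ∧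
        -- all affected nodes become dirty, and no other node does
        (∀ i v, DynMM.Affected (G i) (G (i + 1)) (A.labels G L₀ i) v →
          A.IsDirty G L₀ (i + 1) v) ∧
        (∀ i v, A.IsDirty G L₀ (i + 1) v →
          A.IsDirty G L₀ i v ∨ DynMM.Affected (G i) (G (i + 1)) (A.labels G L₀ i) v) ∧
        -- a deleted node has at most one neighbor that is matched to it
        (∀ i, ∀ w ∈ (G i).nodes, w ∉ (G (i + 1)).nodes → ∀ v v' : Fin n,
          (G i).graph.Adj v w → A.labels G L₀ i v = some w →
          (G i).graph.Adj v' w → A.labels G L₀ i v' = some w → v = v') ∧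
        -- a clean node whose neighbors are all clean has a consistent star
        (∀ i, ∀ v ∈ (G i).nodes, ¬ A.IsDirty G L₀ i v →
          (∀ u, (G i).graph.Adj v u → ¬ A.IsDirty G L₀ i u) →
          DynMM.StarConsistent (G i) (A.labels G L₀ i) v) ∧
        -- the dirty nodes become clean within the same amortized number of rounds
        (∀ i, A.dirtyRounds G L₀ i ≤ k * DynMM.changes G i) := by
  refine ⟨9, 1, fun n => ⟨DynMM.matchingAlgorithm n, ?_, fun G L₀ h => ⟨?_, ?_, ?_, ?_, ?_, ?_, ?_⟩⟩⟩
  · change Fintype.card Bool ≤ _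
    rw [Fintype.card_bool]
    exact Nat.le_self_pow (by omega) 2
  · intro v _
    refine ⟨rfl, ?_⟩
    rintro ⟨-, hv⟩
    cases hv
  · exact fun i => (DynMM.incorrect_le_dirtyRounds G h i).trans (DynMM.dirtyRounds_le G h i)
  · exact fun i v ha => DynMM.isDirty_of_affected G h ha
  · exact fun i v hd => DynMM.isDirty_or_affected G h hd
  · intro i w _ _ v v' ha hl ha' hl'
    have inv := DynMM.inv_run G h i
    have e := (inv.matched v ((G i).mem_of_adj ha) w hl).2
    have e' := (inv.matched v' ((G i).mem_of_adj ha') w hl').2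
    rw [e] at e'
    exact Option.some.inj e'
  · exact fun i v hv hd hn => DynMM.starConsistent_of_clean G h hv hd hn
  · exact fun i => DynMM.dirtyRounds_le G h i
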